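/- All graphs are finite and simple. A total-$k$-coloring of a graph assigns one of $k$ colors to each vertex and each edge so that adjacent vertices, distinct edges sharing an endpoint, and an edge and either of its endpoints always receive different colors. Let $G$ be a planar graph with maximum degree $\Delta$, and let $H$ be a subgraph of $G$ that is a matching, i.e. $H$ consists of vertex-disjoint copies of $K_2$. Let $\varphi$ be a total-$(\Delta+7)$-coloring of $H$ in $G$, that is, a total-$(\Delta+7)$-coloring of $H$ such that any two vertices of $H$ that are adjacent in $G$ receive different colors. Then $\varphi$ extends to $G$: there is a total-$(\Delta+7)$-coloring of $G$ that agrees with $\varphi$ on all vertices and edges of $H$. -/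

import Mathlib

namespace SimpleGraph

/-- The Euclidean plane. -/
abbrev Plane : Type := EuclideanSpace ℝ (Fin 2)

/-- `A` is a simple polygonal arc from `a` to `b`: it is the union of `n` nondegenerate straight
segments `[p i, p (i + 1)]`, `i < n`, with `p 0 = a` and `p n = b`, where consecutive segments meet
only in their common end and other pairs of segments are disjoint. -/
def IsPolygonalArc (a b : Plane) (A : Set Plane) : Prop :=
  ∃ (n : ℕ) (p : ℕ → Plane),
    p 0 = a ∧ p n = b ∧
    A = {x | ∃ i < n, x ∈ segment ℝ (p i) (p (i + 1))} ∧
    (∀ i < n, p i ≠ p (i + 1)) ∧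
    (∀ i j, i < j → j < n →
      ∀ x ∈ segment ℝ (p i) (p (i + 1)), x ∈ segment ℝ (p j) (p (j + 1)) →
        j = i + 1 ∧ x = p j)

/-- A drawing of `G` in the plane without crossings. The values of `arc` at pairs that are not
edges of `G` play no role. -/
structure PlaneDrawing {V : Type*} (G : SimpleGraph V) where
  /-- the point that represents a vertex -/
  pos : V → Plane
  /-- the arc that represents an edge -/
  arc : Sym2 V → Set Plane
  pos_injective : Function.Injective pos
  isPolygonalArc : ∀ u v, G.Adj u v → IsPolygonalArc (pos u) (pos v) (arc s(u, v))
  /-- an edge passes through no vertices other than its ends -/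
  mem_of_pos_mem_arc : ∀ e ∈ G.edgeSet, ∀ w, pos w ∈ arc e → w ∈ e
  /-- two edges meet only in a common end -/
  no_crossing : ∀ e ∈ G.edgeSet, ∀ f ∈ G.edgeSet, e ≠ f →
    ∀ x ∈ arc e, x ∈ arc f → ∃ w, w ∈ e ∧ w ∈ f ∧ x = pos w

/-- A graph is planar if it can be drawn in the plane without crossings. -/
def IsPlanar {V : Type*} (G : SimpleGraph V) : Prop :=
  Nonempty G.PlaneDrawing

/-- A total-`k`-coloring of `G`: the vertices and the edges of `G` receive colors from a set of `k`
colors, so that adjacent vertices, distinct edges with a common end, and an edge and either of its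
ends, receive different colors. -/
structure TotalColoring {V : Type*} (G : SimpleGraph V) (k : ℕ) where
  /-- the color of a vertex -/
  vert : V → Fin k
  /-- the color of an edge -/
  edge : G.edgeSet → Fin k
  vert_ne : ∀ u v, G.Adj u v → vert u ≠ vert v
  edge_ne : ∀ e f : G.edgeSet, e ≠ f → ∀ v, v ∈ e.1 → v ∈ f.1 → edge e ≠ edge f
  vert_ne_edge : ∀ (v : V) (e : G.edgeSet), v ∈ e.1 → vert v ≠ edge e

namespace TotalColoring

variable {V : Type*} {G : SimpleGraph V} {H : G.Subgraph} {k : ℕ}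

/-- The total coloring `φ` of the subgraph `H` is a total coloring of `H` in `G`: it is proper also
with respect to `G`, that is, vertices of `H` that are adjacent in `G` receive different colors.
(For the other two kinds of conflicts, being proper in `H` and in `G` is the same.) -/
def IsIn (φ : H.coe.TotalColoring k) : Prop :=
  ∀ u v : H.verts, G.Adj u v → φ.vert u ≠ φ.vert v

/-- The total coloring `ψ` of `G` agrees with `φ` on all vertices and edges of `H`. -/
def Extends (ψ : G.TotalColoring k) (φ : H.coe.TotalColoring k) : Prop :=
  (∀ v : H.verts, ψ.vert v = φ.vert v) ∧
    ∀ e : H.coe.edgeSet, ψ.edge (H.hom.mapEdgeSet e) = φ.edge e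

end TotalColoring

end SimpleGraph

/-!
Planarity enters only through 5-degeneracy. Shear the plane so that no segment of the drawing is
vertical, and attach to every point off the drawing the functional on the binary cycle space that
gives the parity of the number of edges of a cycle above that point. As the point moves, this
functional changes only when the point crosses an edge, so the sets of edges that have a given
functional on exactly one side are the face boundaries; they span the cycle space and every edge
lies in at most two of them (the easy half of MacLane's criterion). Since a nonzero element of the
cycle space has at least three edges, double counting gives `|E| + 3 ≤ 3 |V|`, hence every subgraph
has a vertex of degree at most 5.

The coloring is extended greedily in the total graph, vertices first. An uncolored vertex meets no
colored edge, because an edge of `H` has both ends in `H`, so `Δ + 1` colors suffice for it. Among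
the uncolored edges, the one to be colored last is an edge `vw` such that `v` lies in at most `d`
uncolored edges, for a `d`-degenerate graph. If `v` lies in at most `m` edges of `H`, then `vw`
conflicts with its two ends, with at most `d + m - 1` edges at `v` and with at most `Δ - 1` edges
at `w`: at most `Δ + d + m` conflicts, which is `Δ + 6` for `d = 5` and `m = 1`.
-/

open Finset SimpleGraph Filter Topology

section BinaryCycleSpace

variable {P E S : Type*}

open Classical in
/-- The boundary over `ZMod 2` of a set of edges, for the incidence relation `inc` between points
and edges: a set is encoded by its indicator function, and its boundary counts the edges at each
point modulo `2`. -/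
noncomputable def binaryBoundary [Fintype E] (inc : P → E → Prop) :
    (E → ZMod 2) →ₗ[ZMod 2] P → ZMod 2 where
  toFun z p := ∑ e with inc p e, z e
  map_add' a b := by funext p; simp only [Pi.add_apply, sum_add_distrib]
  map_smul' r a := by funext p; simp only [Pi.smul_apply, smul_sum, RingHom.id_apply]

/-- The binary cycle space of an incidence relation: the sets of edges that have an even number of
edges at each point. -/
noncomputable def binaryCycleSpace [Fintype E] (inc : P → E → Prop) :
    Submodule (ZMod 2) (E → ZMod 2) :=
  LinearMap.ker (binaryBoundary inc)

open Classical in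
theorem mem_binaryCycleSpace [Fintype E] {inc : P → E → Prop} {z : E → ZMod 2} :
    z ∈ binaryCycleSpace inc ↔ ∀ p, ∑ e with inc p e, z e = 0 :=
  LinearMap.mem_ker.trans funext_iff

theorem binaryCycleSpace_comp_of_surjective {Q : Type*} [Fintype E] (inc : P → E → Prop)
    {f : Q → P} (hf : f.Surjective) :
    binaryCycleSpace (fun q => inc (f q)) = binaryCycleSpace inc := by
  ext z
  simp only [mem_binaryCycleSpace, hf.forall]

theorem binaryCycleSpace_image_of_injective {Q : Type*} [Fintype E] (inc : P → E → Prop)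
    {f : P → Q} (hf : f.Injective) :
    binaryCycleSpace (fun q e => ∃ p, inc p e ∧ f p = q) = binaryCycleSpace inc := by
  classical
  ext z
  simp only [mem_binaryCycleSpace]
  refine ⟨fun h p => by simpa [hf.eq_iff] using h (f p), fun h q => ?_⟩
  by_cases hq : ∃ p, f p = q
  · obtain ⟨p, rfl⟩ := hq
    simpa [hf.eq_iff] using h p
  · rw [filter_false_of_mem fun e _ ⟨p, _, hp⟩ => hq ⟨p, hp⟩, sum_empty]

open Classical in
theorem card_lt_finrank_binaryCycleSpace_add_card [Fintype P] [Fintype E] [Nonempty P]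
    {inc : P → E → Prop} (heven : ∀ e, Even #{p | inc p e}) :
    Fintype.card E < Module.finrank (ZMod 2) (binaryCycleSpace inc) + Fintype.card P := by
  have sum_boundary (z : E → ZMod 2) : ∑ p, binaryBoundary inc z p = 0 := by
    change ∑ p, ∑ e with inc p e, z e = 0
    simp only [sum_filter]
    rw [sum_comm]
    refine sum_eq_zero fun e _ => ?_
    rw [← sum_filter, sum_const, nsmul_eq_mul, (ZMod.natCast_eq_zero_iff_even).2 (heven e),
      zero_mul]
  have range_ne_top : LinearMap.range (binaryBoundary inc) ≠ ⊤ := by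
    intro h
    obtain ⟨p⟩ := ‹Nonempty P›
    obtain ⟨z, hz⟩ := LinearMap.range_eq_top.1 h (Pi.single p 1)
    simpa [hz] using sum_boundary z
  have hrange := Submodule.finrank_lt range_ne_top
  have hrank := (binaryBoundary inc).finrank_range_add_finrank_ker
  rw [Module.finrank_fintype_fun_eq_card] at hrange hrank
  rw [binaryCycleSpace]
  lia

/-- A subspace of the edge space over `ZMod 2` has a *2-basis* (MacLane) if it is spanned by a
finite family that covers every edge at most twice. Linear independence is not required. -/
def HasTwoBasis (C : Submodule (ZMod 2) (E → ZMod 2)) : Prop :=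
  ∃ B : Finset (E → ZMod 2),
    Submodule.span (ZMod 2) (B : Set (E → ZMod 2)) = C ∧ ∀ e, #{b ∈ B | b e ≠ 0} ≤ 2

theorem HasTwoBasis.mul_finrank_le [Fintype E] {C : Submodule (ZMod 2) (E → ZMod 2)} {m : ℕ}
    (hC : HasTwoBasis C) (hm : ∀ z ∈ C, z ≠ 0 → m ≤ #{e | z e ≠ 0}) :
    m * Module.finrank (ZMod 2) C ≤ 2 * Fintype.card E := by
  classical
  obtain ⟨B, hspan, hcover⟩ := hC
  have hfinrank : Module.finrank (ZMod 2) C ≤ #(B.erase 0) := by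
    rw [← hspan, ← Submodule.span_sdiff_singleton_zero, ← coe_erase]
    exact finrank_span_finset_le_card _
  have hcount : #(B.erase 0) * m ≤ #(univ : Finset E) * 2 := by
    refine card_mul_le_card_mul (fun b e => b e ≠ 0) (fun b hb => ?_) fun e _ => ?_
    · exact hm b (hspan ▸ Submodule.subset_span (mem_of_mem_erase hb)) (ne_of_mem_erase hb)
    · exact (card_le_card (filter_subset_filter _ (erase_subset 0 B))).trans (hcover e)
  calc m * Module.finrank (ZMod 2) C ≤ #(B.erase 0) * m := by rw [mul_comm]; gcongr
    _ ≤ 2 * Fintype.card E := by rwa [card_univ, mul_comm (Fintype.card E)] at hcount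

theorem HasTwoBasis.of_family {ι : Type*} [Fintype ι] {C : Submodule (ZMod 2) (E → ZMod 2)}
    (b : ι → E → ZMod 2) (hspan : Submodule.span (ZMod 2) (Set.range b) = C)
    (hcover : ∀ e, #{i | b i e ≠ 0} ≤ 2) : HasTwoBasis C := by
  classical
  refine ⟨univ.image b, by rwa [coe_image, coe_univ, Set.image_univ], fun e => ?_⟩
  rw [filter_image]
  exact card_image_le.trans (hcover e)

theorem HasTwoBasis.of_map_funLeft {C : Submodule (ZMod 2) (E → ZMod 2)} {π : S → E}
    (hπ : π.Surjective) (h : HasTwoBasis (C.map (LinearMap.funLeft (ZMod 2) (ZMod 2) π))) :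
    HasTwoBasis C := by
  classical
  obtain ⟨B, hspan, hcover⟩ := h
  have hinj := LinearMap.funLeft_injective_of_surjective (ZMod 2) (ZMod 2) π hπ
  have hB : (B : Set (S → ZMod 2)) ⊆ LinearMap.funLeft (ZMod 2) (ZMod 2) π '' Set.univ := by
    intro b hb
    obtain ⟨z, -, rfl⟩ := hspan.le (Submodule.subset_span hb)
    exact Set.mem_image_of_mem _ (Set.mem_univ z)
  obtain ⟨B', -, rfl⟩ := Finset.subset_set_image_iff.1 hB
  refine ⟨B', ?_, hπ.forall.2 fun s => ?_⟩
  · rw [coe_image, ← Submodule.map_span] at hspan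
    exact Submodule.map_injective_of_injective hinj hspan
  · specialize hcover s
    rwa [filter_image, card_image_of_injective _ hinj] at hcover

end BinaryCycleSpace

section Telescoping

variable {α β : Type*} [DecidableEq α] [LinearOrder β]

theorem sum_chain_telescope (T : Finset α) {key : α → β} (hkey : Set.InjOn key T)
    (g : Finset α → ZMod 2) :
    ∑ s ∈ T, (g {c ∈ T | key s < key c} + g (insert s {c ∈ T | key s < key c})) = g ∅ + g T := by
  induction T using Finset.induction_on_min_value key with
  | empty => simp only [sum_empty, CharTwo.add_self_eq_zero]
  | insert a T ha hmin ih =>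
    have above_min : {c ∈ insert a T | key a < key c} = T := by
      rw [filter_insert, if_neg (lt_irrefl _), filter_true_of_mem]
      exact fun c hc => (hmin c hc).lt_of_ne fun h =>
        ha (hkey (mem_insert_self a T) (mem_insert_of_mem hc) h ▸ hc)
    have above_of_mem : ∀ s ∈ T, {c ∈ insert a T | key s < key c} = {c ∈ T | key s < key c} :=
      fun s hs => by rw [filter_insert, if_neg (hmin s hs).not_gt]
    rw [sum_insert ha, above_min, sum_congr rfl fun s hs => by rw [above_of_mem s hs],
      ih (hkey.mono (by simp)), add_comm (g ∅), add_add_add_comm, CharTwo.add_self_eq_zero,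
      zero_add, add_comm]

theorem sum_level_telescope (A : Finset α) {key ht : α → β}
    (hmono : ∀ s ∈ A, ∀ c ∈ A, key s < key c → ht s ≤ ht c) (hkey : Set.InjOn key A)
    (g : Finset α → ZMod 2) (y : β) :
    ∑ s ∈ A with ht s = y, (g {c ∈ A | key s < key c} + g (insert s {c ∈ A | key s < key c})) =
      g {c ∈ A | y < ht c} + g {c ∈ A | y ≤ ht c} := by
  set U : Finset α := {c ∈ A | y < ht c}
  set T : Finset α := {c ∈ A | ht c = y}
  have above_eq : ∀ s ∈ T, {c ∈ A | key s < key c} = U ∪ {c ∈ T | key s < key c} := by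
    intro s hs
    ext c
    have := hmono s
    have := hmono c
    have := @hkey s
    have := @hkey c
    grind
  have hUT : {c ∈ A | y ≤ ht c} = U ∪ T := by grind
  have telescope := sum_chain_telescope T (hkey.mono (filter_subset _ _)) fun X => g (U ∪ X)
  rw [union_empty] at telescope
  rw [hUT, ← telescope]
  exact sum_congr rfl fun s hs => by rw [above_eq s hs, union_insert]

end Telescoping

/-- A system of strands in the plane: the strand `s` is the graph of the continuous function
`height s` over the interval `[lo s, hi s]`, and two strands meet only in common ends. The values
of `height s` outside this interval play no role. -/
structure StrandSystem (S : Type*) where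
  /-- the abscissa of the left end of a strand -/
  lo : S → ℝ
  /-- the abscissa of the right end of a strand -/
  hi : S → ℝ
  /-- the function whose graph is the strand -/
  height : S → ℝ → ℝ
  lo_lt_hi : ∀ s, lo s < hi s
  continuous_height : ∀ s, Continuous (height s)
  meet : ∀ s c, s ≠ c → ∀ r ∈ Set.Icc (lo s) (hi s), r ∈ Set.Icc (lo c) (hi c) →
    height s r = height c r → lo s = r ∨ hi s = r

namespace StrandSystem

variable {S : Type*} (A : StrandSystem S)

/-- The incidence relation between points, as pairs of coordinates, and strands: `p` is an end of
the strand `s`. -/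
def IsEnd (p : ℝ × ℝ) (s : S) : Prop :=
  (A.lo s = p.1 ∨ A.hi s = p.1) ∧ A.height s p.1 = p.2

theorem eventually_height_lt [Finite S] {r : ℝ} {l : Filter ℝ} (hl : l ≤ 𝓝 r) :
    ∀ᶠ r' in l, ∀ s c, A.height s r < A.height c r → A.height s r' < A.height c r' :=
  hl <| eventually_all.2 fun s => eventually_all.2 fun c => eventually_imp_distrib_left.2 fun h =>
    ((A.continuous_height s).tendsto r).eventually_lt ((A.continuous_height c).tendsto r) h

theorem height_ne {r : ℝ} {s c : S} (hs : r ∈ Set.Ioo (A.lo s) (A.hi s))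
    (hc : r ∈ Set.Icc (A.lo c) (A.hi c)) (hsc : s ≠ c) : A.height s r ≠ A.height c r :=
  fun h => (A.meet s c hsc r (Set.Ioo_subset_Icc_self hs) hc h).elim hs.1.ne (hs.2.ne' ·)

/-- The abscissa of the midpoint of a strand. -/
noncomputable def mid (s : S) : ℝ := (A.lo s + A.hi s) / 2

theorem mid_mem_Ioo (s : S) : A.mid s ∈ Set.Ioo (A.lo s) (A.hi s) :=
  ⟨left_lt_add_div_two.2 (A.lo_lt_hi s), add_div_two_lt_right.2 (A.lo_lt_hi s)⟩

variable [Fintype S]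

/-- The binary cycle space of a system of strands. -/
noncomputable abbrev cycleSpace : Submodule (ZMod 2) (S → ZMod 2) :=
  binaryCycleSpace A.IsEnd

/-- The strands that the vertical line just to the right of the line at `r` crosses. -/
noncomputable def rightAt (r : ℝ) : Finset S := {s | A.lo s ≤ r ∧ r < A.hi s}

/-- The strands that the vertical line just to the left of the line at `r` crosses. -/
noncomputable def leftAt (r : ℝ) : Finset S := {s | A.lo s < r ∧ r ≤ A.hi s}

/-- The strands that lie above the strand `s` on the vertical line at `r`. -/
noncomputable def above (r : ℝ) (s : S) : Finset S :=
  {c ∈ A.rightAt r | A.height s r < A.height c r}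

/-- The parity vector of a set `T` of strands: it records for every element of the cycle space how
many of its strands lie in `T`, modulo `2`. -/
def parity (T : Finset S) : A.cycleSpace → ZMod 2 := fun z => ∑ c ∈ T, z.1 c

variable {A} in
theorem mem_rightAt {r : ℝ} {s : S} : s ∈ A.rightAt r ↔ A.lo s ≤ r ∧ r < A.hi s := by
  rw [rightAt, mem_filter_univ]

variable {A} in
theorem mem_leftAt {r : ℝ} {s : S} : s ∈ A.leftAt r ↔ A.lo s < r ∧ r ≤ A.hi s := by
  rw [leftAt, mem_filter_univ]

theorem parity_insert_above [DecidableEq S] (r : ℝ) (s : S) (z : A.cycleSpace) :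
    A.parity (insert s (A.above r s)) z = z.1 s + A.parity (A.above r s) z :=
  sum_insert fun h => lt_irrefl _ (mem_filter.1 h).2

-- A strand that passes through the line at `r` is counted twice on the right.
theorem sum_ends_eq_add (f : S → ZMod 2) (r : ℝ) (P : S → Prop) [DecidablePred P] :
    ∑ s with (A.lo s = r ∨ A.hi s = r) ∧ P s, f s =
      ∑ s ∈ A.rightAt r with P s, f s + ∑ s ∈ A.leftAt r with P s, f s := by
  simp only [rightAt, leftAt, filter_filter, sum_filter]
  rw [← sum_add_distrib]
  refine sum_congr rfl fun s _ => ?_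
  have := A.lo_lt_hi s
  have := CharTwo.add_self_eq_zero (f s)
  grind

theorem sum_ends_eq_zero (z : A.cycleSpace) (r : ℝ) (P : ℝ → Prop) [DecidablePred P] :
    ∑ s with (A.lo s = r ∨ A.hi s = r) ∧ P (A.height s r), z.1 s = 0 := by
  classical
  rw [← sum_fiberwise_of_maps_to (t := univ.image fun s => A.height s r)
    (g := fun s => A.height s r) (fun s _ => mem_image_of_mem _ (mem_univ s))]
  refine sum_eq_zero fun y _ => ?_
  rw [filter_filter]
  by_cases hP : P y
  · rw [← mem_binaryCycleSpace.1 z.2 (r, y)]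
    refine sum_congr (filter_congr fun s _ => ?_) fun _ _ => rfl
    grind [IsEnd]
  · rw [filter_false_of_mem (by grind), sum_empty]

theorem parity_leftAt_eq_parity_rightAt (r : ℝ) (P : ℝ → Prop) [DecidablePred P] :
    A.parity {s ∈ A.leftAt r | P (A.height s r)} =
      A.parity {s ∈ A.rightAt r | P (A.height s r)} := by
  funext z
  rw [parity, parity, ← CharTwo.add_eq_zero, add_comm,
    ← A.sum_ends_eq_add z.1 r fun s => P (A.height s r), A.sum_ends_eq_zero]

theorem eventually_rightAt_of_gt (r : ℝ) :
    ∀ᶠ r' in 𝓝[>] r, A.rightAt r' = A.rightAt r ∧ ∀ s ∈ A.rightAt r, A.lo s < r' := by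
  have near : ∀ᶠ r' in 𝓝[>] r, ∀ s, (r < A.lo s → r' < A.lo s) ∧ (r < A.hi s → r' < A.hi s) :=
    eventually_nhdsWithin_of_eventually_nhds <| eventually_all.2 fun s =>
      (eventually_imp_distrib_left.2 eventually_lt_nhds).and
        (eventually_imp_distrib_left.2 eventually_lt_nhds)
  filter_upwards [near, self_mem_nhdsWithin] with r' hr' (hr : r < r')
  refine ⟨?_, ?_⟩
  · ext s
    grind [mem_rightAt]
  · grind [mem_rightAt]

theorem eventually_rightAt_of_lt (r : ℝ) :
    ∀ᶠ r' in 𝓝[<] r, A.rightAt r' = A.leftAt r ∧ ∀ s ∈ A.leftAt r, A.lo s < r' := by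
  have near : ∀ᶠ r' in 𝓝[<] r, ∀ s, (A.lo s < r → A.lo s < r') ∧ (A.hi s < r → A.hi s < r') :=
    eventually_nhdsWithin_of_eventually_nhds <| eventually_all.2 fun s =>
      (eventually_imp_distrib_left.2 eventually_gt_nhds).and
        (eventually_imp_distrib_left.2 eventually_gt_nhds)
  filter_upwards [near, self_mem_nhdsWithin] with r' hr' (hr : r' < r)
  refine ⟨?_, ?_⟩
  · ext s
    grind [mem_rightAt, mem_leftAt]
  · grind [mem_leftAt]

theorem eventually_above_eq {r : ℝ} {l : Filter ℝ} (hl : l ≤ 𝓝 r) {T : Finset S}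
    (hT : ∀ᶠ r' in l, A.rightAt r' = T ∧ ∀ s ∈ T, A.lo s < r') {s : S}
    (hs : ∀ c ∈ T, s ≠ c → A.height s r ≠ A.height c r) :
    ∀ᶠ r' in l, A.above r' s = {c ∈ T | A.height s r < A.height c r} := by
  filter_upwards [hT, A.eventually_height_lt hl] with r' hr' hlt
  rw [above, hr'.1]
  refine filter_congr fun c hc => ⟨fun h => ?_, hlt s c⟩
  have hsc : s ≠ c := fun e => (e ▸ h).ne rfl
  exact (hs c hc hsc).lt_or_gt.resolve_right fun h' => (hlt c s h').not_gt h

theorem eventually_parity_above_eq {r : ℝ} {s : S} (hr : r ∈ Set.Ioo (A.lo s) (A.hi s)) :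
    ∀ᶠ r' in 𝓝 r, A.parity (A.above r' s) = A.parity (A.above r s) := by
  rw [← pure_sup_nhdsNE, ← nhdsLT_sup_nhdsGT]
  refine eventually_sup.2 ⟨rfl, eventually_sup.2 ⟨?_, ?_⟩⟩
  · have left := A.eventually_above_eq nhdsWithin_le_nhds (A.eventually_rightAt_of_lt r)
      fun c hc => A.height_ne hr ⟨(mem_leftAt.1 hc).1.le, (mem_leftAt.1 hc).2⟩
    filter_upwards [left] with r' hr'
    rw [hr', A.parity_leftAt_eq_parity_rightAt r fun y => A.height s r < y, above]
  · have right := A.eventually_above_eq nhdsWithin_le_nhds (A.eventually_rightAt_of_gt r)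
      fun c hc => A.height_ne hr ⟨(mem_rightAt.1 hc).1, (mem_rightAt.1 hc).2.le⟩
    filter_upwards [right] with r' hr'
    rw [hr', above]

theorem parity_above_eq {r r' : ℝ} {s : S} (hr : r ∈ Set.Ioo (A.lo s) (A.hi s))
    (hr' : r' ∈ Set.Ioo (A.lo s) (A.hi s)) :
    A.parity (A.above r s) = A.parity (A.above r' s) := by
  let _ : TopologicalSpace (A.cycleSpace → ZMod 2) := ⊥
  have _ : DiscreteTopology (A.cycleSpace → ZMod 2) := ⟨rfl⟩
  refine isPreconnected_Ioo.constant (f := fun t => A.parity (A.above t s)) (fun t ht => ?_) hr hr'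
  exact (continuousAt_const.congr
    ((A.eventually_parity_above_eq ht).mono fun _ h => h.symm)).continuousWithinAt

open Classical in
/-- The boundary of a face. A face is encoded by the parity vector of the strands above any of its
points, and `s` is in its boundary if the face is on exactly one of the two sides of `s`. -/
noncomputable def faceBoundary (γ : A.cycleSpace → ZMod 2) (s : S) : ZMod 2 :=
  (if A.parity (A.above (A.mid s) s) = γ then 1 else 0) +
    if A.parity (insert s (A.above (A.mid s) s)) = γ then 1 else 0

open Classical in
theorem faceBoundary_eq (γ : A.cycleSpace → ZMod 2) {r : ℝ} {s : S}
    (hr : r ∈ Set.Ioo (A.lo s) (A.hi s)) :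
    A.faceBoundary γ s = (if A.parity (A.above r s) = γ then 1 else 0) +
      if A.parity (insert s (A.above r s)) = γ then 1 else 0 := by
  have h := A.parity_above_eq (A.mid_mem_Ioo s) hr
  have h' : A.parity (insert s (A.above (A.mid s) s)) =
      A.parity (insert s (A.above r s)) := by
    funext z
    rw [parity_insert_above, parity_insert_above, h]
  rw [faceBoundary, h, h']

open Classical in
theorem sum_faceBoundary {r : ℝ} {l : Filter ℝ} [l.NeBot] (hl : l ≤ 𝓝 r) {T : Finset S}
    (hT : ∀ᶠ r' in l, A.rightAt r' = T ∧ ∀ s ∈ T, A.lo s < r') (γ : A.cycleSpace → ZMod 2)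
    (y : ℝ) :
    ∑ s ∈ T with A.height s r = y, A.faceBoundary γ s =
      (if A.parity {c ∈ T | y < A.height c r} = γ then 1 else 0) +
        if A.parity {c ∈ T | y ≤ A.height c r} = γ then 1 else 0 := by
  obtain ⟨r', ⟨rfl, hlo⟩, hlt⟩ := (hT.and (A.eventually_height_lt hl)).exists
  have mem_Ioo : ∀ s ∈ A.rightAt r', r' ∈ Set.Ioo (A.lo s) (A.hi s) :=
    fun s hs => ⟨hlo s hs, (mem_rightAt.1 hs).2⟩
  have injOn : Set.InjOn (fun s => A.height s r') (A.rightAt r') := fun s hs c hc h =>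
    not_not.1 fun hsc =>
      A.height_ne (mem_Ioo s hs) (Set.Ioo_subset_Icc_self (mem_Ioo c hc)) hsc h
  rw [← sum_level_telescope (A.rightAt r') (ht := fun s => A.height s r)
    (fun s _ c _ h => not_lt.1 fun h' => (hlt c s h').not_gt h) injOn
    (fun X => if A.parity X = γ then 1 else 0)]
  exact sum_congr rfl fun s hs => A.faceBoundary_eq γ (mem_Ioo s (mem_filter.1 hs).1)

theorem faceBoundary_mem (γ : A.cycleSpace → ZMod 2) : A.faceBoundary γ ∈ A.cycleSpace := by
  classical
  refine mem_binaryCycleSpace.2 fun ⟨r, y⟩ => ?_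
  have ends := A.sum_ends_eq_add (A.faceBoundary γ) r fun s => A.height s r = y
  rw [A.sum_faceBoundary nhdsWithin_le_nhds (A.eventually_rightAt_of_gt r),
    A.sum_faceBoundary nhdsWithin_le_nhds (A.eventually_rightAt_of_lt r),
    A.parity_leftAt_eq_parity_rightAt r fun t => y < t,
    A.parity_leftAt_eq_parity_rightAt r fun t => y ≤ t, CharTwo.add_self_eq_zero] at ends
  convert ends
  rfl

theorem card_faceBoundary_ne_zero_le [Fintype (A.cycleSpace → ZMod 2)] (s : S) :
    #{γ | A.faceBoundary γ s ≠ 0} ≤ 2 := by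
  classical
  have sides : ({γ | A.faceBoundary γ s ≠ 0} : Finset (A.cycleSpace → ZMod 2)) ⊆
      {A.parity (A.above (A.mid s) s),
        A.parity (insert s (A.above (A.mid s) s))} := by
    intro γ hγ
    rw [mem_filter_univ, faceBoundary] at hγ
    grind
  exact (card_le_card sides).trans card_le_two

theorem sum_smul_faceBoundary [Fintype (A.cycleSpace → ZMod 2)] (z : A.cycleSpace) :
    ∑ γ, γ z • A.faceBoundary γ = z.1 := by
  classical
  funext s
  rw [Finset.sum_apply]
  simp only [Pi.smul_apply, faceBoundary, smul_eq_mul, mul_add, sum_add_distrib, mul_ite, mul_one,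
    mul_zero, sum_ite_eq, mem_univ, if_true, parity_insert_above]
  rw [add_comm, add_assoc, CharTwo.add_self_eq_zero, add_zero]

theorem hasTwoBasis_cycleSpace : HasTwoBasis A.cycleSpace := by
  classical
  have := Fintype.ofFinite (A.cycleSpace → ZMod 2)
  refine .of_family A.faceBoundary (le_antisymm ?_ fun z hz => ?_) A.card_faceBoundary_ne_zero_le
  · exact Submodule.span_le.2 (Set.range_subset_iff.2 A.faceBoundary_mem)
  · rw [← show ∑ γ, γ ⟨z, hz⟩ • A.faceBoundary γ = z from A.sum_smul_faceBoundary ⟨z, hz⟩]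
    exact Submodule.sum_mem _ fun γ _ => Submodule.smul_mem _ _
      (Submodule.subset_span (Set.mem_range_self γ))

end StrandSystem

/-- A system of nondegenerate segments in the plane that meet only in common ends. -/
structure SegmentSystem (S : Type*) where
  /-- one end of a segment -/
  src : S → Plane
  /-- the other end of a segment -/
  tgt : S → Plane
  src_ne_tgt : ∀ s, src s ≠ tgt s
  meet : ∀ s c, s ≠ c → ∀ x ∈ segment ℝ (src s) (tgt s), x ∈ segment ℝ (src c) (tgt c) →
    src s = x ∨ tgt s = x

/-- The first coordinate after a horizontal shear. A generic shear makes all segments of a finite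
system nonvertical. -/
noncomputable def shear (τ : ℝ) : Plane →L[ℝ] ℝ :=
  EuclideanSpace.proj 0 + τ • EuclideanSpace.proj 1

theorem shear_apply (τ : ℝ) (x : Plane) : shear τ x = x 0 + τ * x 1 := rfl

theorem bijective_shear_prod (τ : ℝ) : Function.Bijective fun x : Plane => (shear τ x, x 1) := by
  refine ⟨fun x y h => ?_, fun ⟨r, y⟩ => ⟨!₂[r - τ * y, y], by simp [shear_apply]⟩⟩
  simp only [shear_apply, Prod.mk.injEq] at h
  ext i
  fin_cases i
  · simpa [h.2] using h.1
  · exact h.2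

theorem min_eq_or_max_eq_iff {α : Type*} [LinearOrder α] {a b r : α} :
    min a b = r ∨ max a b = r ↔ a = r ∨ b = r := by
  grind

namespace SegmentSystem

variable {S : Type*} (A : SegmentSystem S)

theorem exists_forall_shear_ne [Finite S] :
    ∃ τ, ∀ s, shear τ (A.src s) ≠ shear τ (A.tgt s) := by
  classical
  have := Fintype.ofFinite S
  obtain ⟨τ, hτ⟩ := Infinite.exists_notMem_finset
    (univ.image fun s => (A.tgt s 0 - A.src s 0) / (A.src s 1 - A.tgt s 1))
  refine ⟨τ, fun s h => ?_⟩
  by_cases horizontal : A.src s 1 = A.tgt s 1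
  · exact A.src_ne_tgt s ((bijective_shear_prod τ).1 (Prod.ext h horizontal))
  · refine hτ (mem_image.2 ⟨s, mem_univ _, ?_⟩)
    rw [div_eq_iff (sub_ne_zero.2 horizontal)]
    rw [shear_apply, shear_apply] at h
    linarith

/-- The point with sheared first coordinate `r` on the line through the segment `s`. -/
noncomputable def pointAt (τ : ℝ) (s : S) (r : ℝ) : Plane :=
  AffineMap.lineMap (A.src s) (A.tgt s)
    ((r - shear τ (A.src s)) / (shear τ (A.tgt s) - shear τ (A.src s)))

section

variable {A} {τ : ℝ} {s : S} (h : shear τ (A.src s) ≠ shear τ (A.tgt s))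
include h

theorem pointAt_lineMap (t : ℝ) :
    A.pointAt τ s (AffineMap.lineMap (shear τ (A.src s)) (shear τ (A.tgt s)) t) =
      AffineMap.lineMap (A.src s) (A.tgt s) t := by
  rw [pointAt, AffineMap.lineMap_apply_ring', add_sub_cancel_right,
    mul_div_cancel_right₀ _ (sub_ne_zero.2 h.symm)]

theorem pointAt_shear_src : A.pointAt τ s (shear τ (A.src s)) = A.src s := by
  simpa using pointAt_lineMap h 0

theorem pointAt_shear_tgt : A.pointAt τ s (shear τ (A.tgt s)) = A.tgt s := by
  simpa using pointAt_lineMap h 1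

theorem shear_pointAt (r : ℝ) : shear τ (A.pointAt τ s r) = r := by
  have h' := sub_ne_zero.2 h.symm
  rw [pointAt, AffineMap.lineMap_apply]
  simp [h']

theorem pointAt_mem_segment {r : ℝ}
    (hr : r ∈ Set.uIcc (shear τ (A.src s)) (shear τ (A.tgt s))) :
    A.pointAt τ s r ∈ segment ℝ (A.src s) (A.tgt s) := by
  rw [← segment_eq_uIcc, segment_eq_image_lineMap] at hr
  obtain ⟨t, ht, rfl⟩ := hr
  rw [pointAt_lineMap h, segment_eq_image_lineMap]
  exact Set.mem_image_of_mem _ ht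

end

/-- Seen in sheared coordinates, segments are strands. -/
noncomputable def toStrandSystem {τ : ℝ} (hτ : ∀ s, shear τ (A.src s) ≠ shear τ (A.tgt s)) :
    StrandSystem S where
  lo s := min (shear τ (A.src s)) (shear τ (A.tgt s))
  hi s := max (shear τ (A.src s)) (shear τ (A.tgt s))
  height s r := A.pointAt τ s r 1
  lo_lt_hi s := min_lt_max.2 (hτ s)
  continuous_height s := by
    unfold pointAt
    fun_prop
  meet s c hsc r hs hc h := by
    have points_eq : A.pointAt τ s r = A.pointAt τ c r := (bijective_shear_prod τ).1 <|
      Prod.ext ((shear_pointAt (hτ s) r).trans (shear_pointAt (hτ c) r).symm) h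
    have ends := A.meet s c hsc _ (pointAt_mem_segment (hτ s) hs)
      (points_eq ▸ pointAt_mem_segment (hτ c) hc)
    rw [min_eq_or_max_eq_iff, ← shear_pointAt (hτ s) r]
    exact ends.imp (congrArg _) (congrArg _)

theorem isEnd_toStrandSystem_iff {τ : ℝ} (hτ : ∀ s, shear τ (A.src s) ≠ shear τ (A.tgt s))
    (x : Plane) (s : S) :
    (A.toStrandSystem hτ).IsEnd (shear τ x, x 1) s ↔ A.src s = x ∨ A.tgt s = x := by
  rw [StrandSystem.IsEnd, toStrandSystem, min_eq_or_max_eq_iff]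
  constructor
  · rintro ⟨h | h, hy⟩ <;> rw [← h] at hy
    · exact Or.inl ((bijective_shear_prod τ).1 (Prod.ext h (pointAt_shear_src (hτ s) ▸ hy)))
    · exact Or.inr ((bijective_shear_prod τ).1 (Prod.ext h (pointAt_shear_tgt (hτ s) ▸ hy)))
  · rintro (rfl | rfl)
    · exact ⟨Or.inl rfl, congrArg (· 1) (pointAt_shear_src (hτ s))⟩
    · exact ⟨Or.inr rfl, congrArg (· 1) (pointAt_shear_tgt (hτ s))⟩

theorem hasTwoBasis_binaryCycleSpace [Fintype S] :
    HasTwoBasis (binaryCycleSpace fun x s => A.src s = x ∨ A.tgt s = x) := by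
  obtain ⟨τ, hτ⟩ := A.exists_forall_shear_ne
  have ends : (fun x s => A.src s = x ∨ A.tgt s = x) =
      fun x => (A.toStrandSystem hτ).IsEnd (shear τ x, x 1) :=
    funext₂ fun x s => propext (A.isEnd_toStrandSystem_iff hτ x s).symm
  rw [ends, binaryCycleSpace_comp_of_surjective _ (bijective_shear_prod τ).2]
  exact (A.toStrandSystem hτ).hasTwoBasis_cycleSpace

end SegmentSystem

/-- `p 0, …, p n` are the successive vertices of a simple polygonal arc, as in
`IsPolygonalArc`. -/
structure IsSimplePolyline (n : ℕ) (p : ℕ → Plane) : Prop where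
  ne_succ : ∀ i < n, p i ≠ p (i + 1)
  meet : ∀ i j, i < j → j < n → ∀ x ∈ segment ℝ (p i) (p (i + 1)),
    x ∈ segment ℝ (p j) (p (j + 1)) → j = i + 1 ∧ x = p j

theorem mem_segment_of_eq_or_eq {a b x : Plane} (h : a = x ∨ b = x) : x ∈ segment ℝ a b := by
  rcases h with rfl | rfl
  · exact left_mem_segment ℝ a b
  · exact right_mem_segment ℝ a b

theorem sum_range_add_succ_charTwo (f : ℕ → ZMod 2) (n : ℕ) :
    ∑ i ∈ range n, (f i + f (i + 1)) = f 0 + f n := by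
  simp_rw [← CharTwo.sub_eq_add, ← neg_sub (f (_ + 1)), sum_neg_distrib, sum_range_sub, neg_sub]

theorem ite_or_eq_add_charTwo {p q : Prop} [Decidable p] [Decidable q] (h : ¬(p ∧ q)) :
    (if p ∨ q then 1 else 0 : ZMod 2) = (if p then 1 else 0) + if q then 1 else 0 := by
  split_ifs <;> simp_all

namespace IsSimplePolyline

variable {n : ℕ} {p : ℕ → Plane} (h : IsSimplePolyline n p) {i j : ℕ}
include h

theorem eq_zero_of_start_mem_segment (hi : i < n) (hmem : p 0 ∈ segment ℝ (p i) (p (i + 1))) :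
    i = 0 := by
  by_contra hne
  obtain ⟨h1, h2⟩ := h.meet 0 i (by lia) hi (p 0) (left_mem_segment ℝ _ _) hmem
  exact h.ne_succ 0 (by lia) (h1 ▸ h2)

theorem succ_eq_of_end_mem_segment (hi : i < n) (hmem : p n ∈ segment ℝ (p i) (p (i + 1))) :
    i + 1 = n := by
  by_contra hne
  obtain ⟨k, rfl⟩ : ∃ k, n = k + 1 := ⟨n - 1, by lia⟩
  obtain ⟨-, hk⟩ := h.meet i k (by lia) (by lia) _ hmem (right_mem_segment ℝ _ _)
  exact h.ne_succ k (by lia) hk.symm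

theorem eq_end_of_mem_segment_of_ne (hi : i < n) (hj : j < n) (hij : i ≠ j) {x : Plane}
    (hxi : x ∈ segment ℝ (p i) (p (i + 1))) (hxj : x ∈ segment ℝ (p j) (p (j + 1))) :
    p i = x ∨ p (i + 1) = x := by
  rcases lt_or_gt_of_ne hij with hlt | hlt
  · obtain ⟨rfl, rfl⟩ := h.meet i j hlt hj x hxi hxj
    exact Or.inr rfl
  · obtain ⟨-, rfl⟩ := h.meet j i hlt hi x hxj hxi
    exact Or.inl rfl

theorem eq_succ_iff_of_succ_lt (hi : i + 1 < n) (hj : j < n) :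
    (p j = p (i + 1) ∨ p (j + 1) = p (i + 1)) ↔ j = i ∨ j = i + 1 := by
  refine ⟨fun hend => ?_, ?_⟩
  · have hmem := mem_segment_of_eq_or_eq hend
    by_contra! hne
    rcases lt_or_gt_of_ne hne.1 with hlt | hgt
    · have := h.meet j (i + 1) (by lia) hi _ hmem (left_mem_segment ℝ _ _)
      lia
    · have := h.meet i j hgt hj _ (right_mem_segment ℝ _ _) hmem
      lia
  · rintro (rfl | rfl)
    · exact Or.inr rfl
    · exact Or.inl rfl

open Classical in
theorem sum_ends (hne : p 0 ≠ p n) (x : Plane) :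
    ∑ i : Fin n, (if p i = x ∨ p (i + 1) = x then 1 else 0 : ZMod 2) =
      if p 0 = x ∨ p n = x then 1 else 0 := by
  have not_both {a b : Plane} (hab : a ≠ b) : ¬(a = x ∧ b = x) := fun ⟨ha, hb⟩ =>
    hab (ha.trans hb.symm)
  rw [ite_or_eq_add_charTwo (not_both hne),
    ← sum_range_add_succ_charTwo (fun i => if p i = x then 1 else 0), ← Fin.sum_univ_eq_sum_range]
  exact sum_congr rfl fun i _ => ite_or_eq_add_charTwo (not_both (h.ne_succ i i.2))

end IsSimplePolyline

/-- A system of simple polygonal arcs in the plane that meet only in common ends. The arc `e` has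
the vertices `vertex e 0, …, vertex e (length e)`. -/
structure PolylineSystem (E : Type*) where
  /-- the number of segments of an arc -/
  length : E → ℕ
  /-- the vertices of an arc -/
  vertex : E → ℕ → Plane
  isSimplePolyline : ∀ e, IsSimplePolyline (length e) (vertex e)
  start_ne_end : ∀ e, vertex e 0 ≠ vertex e (length e)
  meet : ∀ e f, e ≠ f → ∀ i < length e, ∀ j < length f,
    ∀ x ∈ segment ℝ (vertex e i) (vertex e (i + 1)),
      x ∈ segment ℝ (vertex f j) (vertex f (j + 1)) → vertex e 0 = x ∨ vertex e (length e) = x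

namespace PolylineSystem

variable {E : Type*} (A : PolylineSystem E)

/-- The point `x` is one of the two ends of the arc `e`. -/
def IsEnd (x : Plane) (e : E) : Prop :=
  A.vertex e 0 = x ∨ A.vertex e (A.length e) = x

theorem length_pos (e : E) : 0 < A.length e :=
  Nat.pos_of_ne_zero fun h => A.start_ne_end e (by rw [h])

/-- The segments that the arcs consist of. -/
def segments : SegmentSystem (Σ e, Fin (A.length e)) where
  src s := A.vertex s.1 s.2
  tgt s := A.vertex s.1 (s.2 + 1)
  src_ne_tgt s := (A.isSimplePolyline s.1).ne_succ s.2 s.2.2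
  meet := by
    rintro ⟨e, i⟩ ⟨f, j⟩ hne x hx hx'
    by_cases hef : e = f
    · subst hef
      exact (A.isSimplePolyline e).eq_end_of_mem_segment_of_ne i.2 j.2
        (fun h => hne (by rw [Fin.ext h])) hx hx'
    · rcases A.meet e f hef i i.2 j j.2 x hx hx' with rfl | rfl
      · exact Or.inl (by rw [(A.isSimplePolyline e).eq_zero_of_start_mem_segment i.2 hx])
      · exact Or.inr (by rw [(A.isSimplePolyline e).succ_eq_of_end_mem_segment i.2 hx])

theorem segments_end_eq_bend_iff {e : E} {i : ℕ} (hi : i + 1 < A.length e)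
    (s : Σ e, Fin (A.length e)) :
    A.segments.src s = A.vertex e (i + 1) ∨ A.segments.tgt s = A.vertex e (i + 1) ↔
      s = ⟨e, i, by lia⟩ ∨ s = ⟨e, i + 1, hi⟩ := by
  obtain ⟨f, j⟩ := s
  by_cases hfe : f = e
  · subst hfe
    simpa [segments, Fin.ext_iff] using (A.isSimplePolyline f).eq_succ_iff_of_succ_lt hi j.2
  · have not_end : ¬(A.segments.src ⟨f, j⟩ = A.vertex e (i + 1) ∨
        A.segments.tgt ⟨f, j⟩ = A.vertex e (i + 1)) := by
      intro hend
      rcases A.meet e f (Ne.symm hfe) (i + 1) hi j j.2 _ (left_mem_segment ℝ _ _)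
        (mem_segment_of_eq_or_eq hend) with h | h
      · have := (A.isSimplePolyline e).eq_zero_of_start_mem_segment hi
          (h ▸ left_mem_segment ℝ _ _)
        lia
      · have := (A.isSimplePolyline e).succ_eq_of_end_mem_segment (i := i) (by lia)
          (h ▸ right_mem_segment ℝ _ _)
        lia
    simp [not_end, hfe]

variable [Fintype E]

theorem comp_fst_mem_binaryCycleSpace_iff (z : E → ZMod 2) :
    (fun s => z s.1) ∈
        binaryCycleSpace (fun x s => A.segments.src s = x ∨ A.segments.tgt s = x) ↔
      z ∈ binaryCycleSpace A.IsEnd := by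
  simp only [mem_binaryCycleSpace]
  refine forall_congr' fun x => ?_
  rw [sum_filter, sum_filter, Fintype.sum_sigma]
  refine Eq.congr_left (sum_congr rfl fun e _ => ?_)
  have hsum := congrArg (z e * ·) ((A.isSimplePolyline e).sum_ends (A.start_ne_end e) x)
  simp only [mul_sum, mul_ite, mul_one, mul_zero] at hsum
  convert hsum <;> rfl

theorem eq_of_mem_binaryCycleSpace_segments {z : (Σ e, Fin (A.length e)) → ZMod 2}
    (hz : z ∈ binaryCycleSpace fun x s => A.segments.src s = x ∨ A.segments.tgt s = x)
    (e : E) (i : ℕ) (hi : i < A.length e) : z ⟨e, i, hi⟩ = z ⟨e, 0, A.length_pos e⟩ := by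
  classical
  induction i with
  | zero => rfl
  | succ i ih =>
    rw [← ih (by lia)]
    have hbend := mem_binaryCycleSpace.1 hz (A.vertex e (i + 1))
    simp only [A.segments_end_eq_bend_iff hi] at hbend
    rw [filter_or, filter_eq' univ, filter_eq' univ, if_pos (mem_univ _), if_pos (mem_univ _),
      ← insert_eq, sum_pair (by simp)] at hbend
    exact (CharTwo.add_eq_zero.1 hbend).symm

theorem map_funLeft_fst_binaryCycleSpace :
    (binaryCycleSpace A.IsEnd).map
        (LinearMap.funLeft (ZMod 2) (ZMod 2) (Sigma.fst : (Σ e, Fin (A.length e)) → E)) =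
      binaryCycleSpace fun x s => A.segments.src s = x ∨ A.segments.tgt s = x := by
  ext z
  constructor
  · rintro ⟨z, hz, rfl⟩
    exact (A.comp_fst_mem_binaryCycleSpace_iff z).2 hz
  · intro hz
    have eq_comp : (fun s => z ⟨s.1, 0, A.length_pos s.1⟩) = z :=
      funext fun s => (A.eq_of_mem_binaryCycleSpace_segments hz s.1 s.2 s.2.2).symm
    refine ⟨fun e => z ⟨e, 0, A.length_pos e⟩, ?_, eq_comp⟩
    exact (A.comp_fst_mem_binaryCycleSpace_iff _).1 (eq_comp.symm ▸ hz)

theorem hasTwoBasis_binaryCycleSpace : HasTwoBasis (binaryCycleSpace A.IsEnd) := by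
  have fst_surjective : Function.Surjective (Sigma.fst : (Σ e, Fin (A.length e)) → E) :=
    fun e => ⟨⟨e, 0, A.length_pos e⟩, rfl⟩
  refine HasTwoBasis.of_map_funLeft fst_surjective ?_
  rw [map_funLeft_fst_binaryCycleSpace]
  exact A.segments.hasTwoBasis_binaryCycleSpace

end PolylineSystem

section PlanarGraph

variable {V : Type*} {G : SimpleGraph V}

theorem exists_polylineSystem (D : G.PlaneDrawing) :
    ∃ A : PolylineSystem G.edgeSet, ∀ x e, A.IsEnd x e ↔ ∃ v, v ∈ e.1 ∧ D.pos v = x := by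
  have harc (e : G.edgeSet) : ∃ (a b : V) (n : ℕ) (p : ℕ → Plane), e.1 = s(a, b) ∧ a ≠ b ∧
      p 0 = D.pos a ∧ p n = D.pos b ∧
      D.arc e.1 = {x | ∃ i < n, x ∈ segment ℝ (p i) (p (i + 1))} ∧ IsSimplePolyline n p := by
    obtain ⟨e, he⟩ := e
    induction e with | _ a b
    obtain ⟨n, p, h0, hn, harc, hne, hmeet⟩ := D.isPolygonalArc a b he
    exact ⟨a, b, n, p, rfl, G.ne_of_adj he, h0, hn, harc, hne, hmeet⟩
  choose a b n p hends hab hstart hend harc hp using harc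
  have ends_iff (x : Plane) (e : G.edgeSet) :
      p e 0 = x ∨ p e (n e) = x ↔ ∃ v, v ∈ e.1 ∧ D.pos v = x := by
    simp [hends, hstart, hend]
  refine ⟨⟨n, p, hp, fun e => ?_, fun e f hef i hi j hj x hxi hxj => ?_⟩, ends_iff⟩
  · rw [hstart, hend]
    exact D.pos_injective.ne (hab e)
  · obtain ⟨w, hwe, -, rfl⟩ := D.no_crossing e.1 e.2 f.1 f.2 (Subtype.coe_ne_coe.2 hef) x
      (harc e ▸ ⟨i, hi, hxi⟩) (harc f ▸ ⟨j, hj, hxj⟩)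
    exact (ends_iff _ e).2 ⟨w, hwe, rfl⟩

theorem hasTwoBasis_of_isPlanar [Fintype G.edgeSet] (hG : G.IsPlanar) :
    HasTwoBasis (binaryCycleSpace fun v (e : G.edgeSet) => v ∈ e.1) := by
  obtain ⟨D⟩ := hG
  obtain ⟨A, hA⟩ := exists_polylineSystem D
  rw [← binaryCycleSpace_image_of_injective _ D.pos_injective]
  have ends : A.IsEnd = fun x e => ∃ v, v ∈ e.1 ∧ D.pos v = x :=
    funext₂ fun x e => propext (hA x e)
  exact ends ▸ A.hasTwoBasis_binaryCycleSpace

end PlanarGraph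

section EdgeBound

variable {V : Type*} {G : SimpleGraph V}

theorem three_le_card_support_of_mem_binaryCycleSpace [Fintype G.edgeSet]
    {z : G.edgeSet → ZMod 2} (hz : z ∈ binaryCycleSpace fun v (e : G.edgeSet) => v ∈ e.1)
    (hz0 : z ≠ 0) : 3 ≤ #{e | z e ≠ 0} := by
  have exists_other {e : G.edgeSet} {v : V} (hv : v ∈ e.1) (he : z e ≠ 0) :
      ∃ f, f ≠ e ∧ v ∈ f.1 ∧ z f ≠ 0 := by
    by_contra! only_e
    have boundary_eq_zero := mem_binaryCycleSpace.1 hz v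
    rw [sum_filter, Fintype.sum_eq_single e, if_pos hv] at boundary_eq_zero
    · exact he boundary_eq_zero
    · exact fun f hfe => by simpa using only_e f hfe
  classical
  obtain ⟨⟨e, hab⟩, he⟩ := Function.ne_iff.1 hz0
  induction e with | _ a b
  obtain ⟨f, hfe, haf, hf⟩ := exists_other (Sym2.mem_mk_left a b) he
  obtain ⟨g, hge, hbg, hg⟩ := exists_other (Sym2.mem_mk_right a b) he
  have hfg : f ≠ g := by
    rintro rfl
    exact hfe (Subtype.ext ((Sym2.mem_and_mem_iff (G.ne_of_adj hab)).1 ⟨haf, hbg⟩))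
  rw [← card_eq_three.2 ⟨_, f, g, hfe.symm, hge.symm, hfg, rfl⟩]
  refine card_le_card fun x hx => ?_
  simp only [mem_insert, mem_singleton] at hx
  rcases hx with rfl | rfl | rfl <;> simpa

theorem card_edgeFinset_add_three_le_of_isPlanar [Fintype V] [Nonempty V] [Fintype G.edgeSet]
    (hG : G.IsPlanar) : #G.edgeFinset + 3 ≤ 3 * Fintype.card V := by
  classical
  have even_card_ends (e : G.edgeSet) : Even #{v | v ∈ e.1} := by
    have ends_eq : ({v | v ∈ e.1} : Finset V) = e.1.toFinset := by ext; simp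
    rw [ends_eq, Sym2.card_toFinset_of_not_isDiag _ (G.not_isDiag_of_mem_edgeSet e.2)]
    exact even_two
  have finrank_lower := card_lt_finrank_binaryCycleSpace_add_card
    fun e => by convert even_card_ends e
  have finrank_upper := (hasTwoBasis_of_isPlanar hG).mul_finrank_le
    fun z => three_le_card_support_of_mem_binaryCycleSpace
  rw [edgeFinset_card]
  lia

theorem exists_degree_le_five_of_isPlanar [Fintype V] [Nonempty V] [DecidableRel G.Adj]
    (hG : G.IsPlanar) : ∃ v, G.degree v ≤ 5 := by
  by_contra! large
  have degree_sum : #univ • 6 ≤ ∑ v, G.degree v := card_nsmul_le_sum univ _ 6 fun v _ => large v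
  rw [sum_degrees_eq_twice_card_edges, card_univ, smul_eq_mul] at degree_sum
  have := card_edgeFinset_add_three_le_of_isPlanar hG
  lia

theorem isPlanar_of_isContained {W : Type*} {G' : SimpleGraph W} (h : G' ⊑ G)
    (hG : G.IsPlanar) : G'.IsPlanar := by
  obtain ⟨f⟩ := h
  obtain ⟨D⟩ := hG
  have map_mem {e : Sym2 W} (he : e ∈ G'.edgeSet) : e.map f ∈ G.edgeSet :=
    f.toHom.map_mem_edgeSet he
  refine ⟨⟨D.pos ∘ f, fun e => D.arc (e.map f), D.pos_injective.comp f.injective,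
    fun u v huv => D.isPolygonalArc _ _ (f.toHom.map_adj huv), fun e he w hw => ?_,
    fun e he e' he' hne x hx hx' => ?_⟩⟩
  · obtain ⟨v, hv, hvw⟩ := Sym2.mem_map.1 (D.mem_of_pos_mem_arc _ (map_mem he) _ hw)
    exact f.injective hvw ▸ hv
  · obtain ⟨w, hw, hw', rfl⟩ := D.no_crossing _ (map_mem he) _ (map_mem he')
      ((Sym2.map.injective f.injective).ne hne) x hx hx'
    obtain ⟨v, hv, rfl⟩ := Sym2.mem_map.1 hw
    obtain ⟨v', hv', hvv'⟩ := Sym2.mem_map.1 hw'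
    exact ⟨v, hv, f.injective hvv' ▸ hv', rfl⟩

end EdgeBound

section Degenerate

variable {V : Type*} {G : SimpleGraph V}

/-- A graph is `d`-degenerate if every nonempty finite set of vertices contains a vertex with at
most `d` neighbors in that set. -/
def IsDegenerate (G : SimpleGraph V) (d : ℕ) : Prop :=
  ∀ U : Finset V, U.Nonempty → ∃ v ∈ U, (G.neighborSet v ∩ U).ncard ≤ d

theorem isDegenerate_five_of_isPlanar (hG : G.IsPlanar) : IsDegenerate G 5 := by
  classical
  intro U hU
  have := hU.to_subtype
  obtain ⟨v, hv⟩ := exists_degree_le_five_of_isPlanar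
    (isPlanar_of_isContained ⟨(Embedding.induce (G := G) (U : Set V)).toCopy⟩ hG)
  refine ⟨v, v.2, ?_⟩
  have neighbors_eq : G.neighborSet v ∩ U =
      Subtype.val '' ((G.induce (U : Set V)).neighborFinset v : Set (U : Set V)) := by
    ext w
    simp [and_comm]
  rwa [neighbors_eq, Set.ncard_image_of_injective _ Subtype.val_injective,
    Set.ncard_coe_finset]

theorem ncard_incident_le {F : Set G.edgeSet} {v : V} {N : Set V} (hN : N.Finite)
    (h : ∀ f ∈ F, ∀ w, f.1 = s(v, w) → w ∈ N) : {f ∈ F | v ∈ f.1}.ncard ≤ N.ncard := by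
  rw [← Set.ncard_image_of_injective _ Subtype.val_injective]
  have incident_subset : Subtype.val '' {f ∈ F | v ∈ f.1} ⊆ (fun w => s(v, w)) '' N := by
    rintro _ ⟨f, ⟨hf, w, hw⟩, rfl⟩
    exact ⟨w, h f hf w hw, hw.symm⟩
  exact (Set.ncard_le_ncard incident_subset (hN.image _)).trans (Set.ncard_image_le hN)

theorem IsDegenerate.exists_ncard_incident_le {d : ℕ} (h : IsDegenerate G d)
    {F : Set G.edgeSet} (hF : F.Finite) (hne : F.Nonempty) :
    ∃ e ∈ F, ∃ v ∈ e.1, {f ∈ F | v ∈ f.1}.ncard ≤ d := by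
  classical
  let ends : Finset V := hF.toFinset.biUnion fun e => e.1.toFinset
  have mem_ends {v : V} : v ∈ ends ↔ ∃ e ∈ F, v ∈ e.1 := by simp [ends]
  obtain ⟨e, he⟩ := hne
  obtain ⟨v, hv, hdegree⟩ := h ends ⟨e.1.out.1, mem_ends.2 ⟨e, he, e.1.out_fst_mem⟩⟩
  obtain ⟨e, he, hve⟩ := mem_ends.1 hv
  refine ⟨e, he, v, hve, le_trans (ncard_incident_le (ends.finite_toSet.inter_of_right _) ?_)
    hdegree⟩
  intro f hf w hw
  exact ⟨G.mem_edgeSet.1 (hw ▸ f.2), mem_ends.2 ⟨f, hf, hw ▸ Sym2.mem_mk_right v w⟩⟩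

end Degenerate

theorem exists_coloring_eqOn {X C : Type*} [Finite X] (K : SimpleGraph X) {X₀ : Set X} {c₀ : X → C}
    (h₀ : ∀ x ∈ X₀, ∀ y ∈ X₀, K.Adj x y → c₀ x ≠ c₀ y)
    (h : ∀ Y, X₀ ⊂ Y → ∃ x ∈ Y \ X₀, (K.neighborSet x ∩ Y).ncard < Nat.card C) :
    ∃ c : K.Coloring C, Set.EqOn c c₀ X₀ := by
  classical
  suffices greedy : ∀ Y, X₀ ⊆ Y → ∃ c : X → C,
      (∀ x ∈ Y, ∀ y ∈ Y, K.Adj x y → c x ≠ c y) ∧ Set.EqOn c c₀ X₀ by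
    obtain ⟨c, hc, hc₀⟩ := greedy Set.univ (Set.subset_univ _)
    exact ⟨Coloring.mk c fun hxy => hc _ trivial _ trivial hxy, hc₀⟩
  intro Y hY
  induction Y using WellFoundedLT.induction with | _ Y ih
  rcases hY.eq_or_ssubset with rfl | hY
  · exact ⟨c₀, h₀, Set.eqOn_refl _ _⟩
  obtain ⟨x, ⟨hxY, hxX₀⟩, hx⟩ := h Y hY
  obtain ⟨c, hc, hc₀⟩ := ih (Y \ {x}) (Set.sdiff_singleton_ssubset.2 hxY)
    (Set.subset_sdiff_singleton hY.subset hxX₀)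
  have : Finite C := Nat.finite_of_card_ne_zero (by lia)
  obtain ⟨a, ha⟩ : ∃ a, a ∉ c '' (K.neighborSet x ∩ Y) := by
    by_contra! all_used
    have := Set.ncard_image_le (f := c) (Set.toFinite (K.neighborSet x ∩ Y))
    rw [Set.eq_univ_of_forall all_used, Set.ncard_univ] at this
    lia
  have a_ne {y : X} (hy : y ∈ Y) (hxy : K.Adj x y) : a ≠ c y :=
    fun hay => ha ⟨y, ⟨hxy, hy⟩, hay.symm⟩
  refine ⟨Function.update c x a, fun y hy z hz hyz => ?_, fun y hy => ?_⟩
  · by_cases hyx : y = x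
    · subst hyx
      rw [Function.update_self, Function.update_of_ne hyz.ne']
      exact a_ne hz hyz
    by_cases hzx : z = x
    · subst hzx
      rw [Function.update_self, Function.update_of_ne hyx]
      exact (a_ne hy hyz.symm).symm
    rw [Function.update_of_ne hyx, Function.update_of_ne hzx]
    exact hc y ⟨hy, hyx⟩ z ⟨hz, hzx⟩ hyz
  · rw [Function.update_of_ne (ne_of_mem_of_not_mem hy hxX₀), hc₀ hy]

section TotalGraph

variable {V : Type*} {G : SimpleGraph V}

/-- The total graph of `G`: its vertices are the vertices and the edges of `G`, and its proper
colorings are the total colorings of `G`. -/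
def totalGraph (G : SimpleGraph V) : SimpleGraph (V ⊕ G.edgeSet) where
  Adj
    | .inl u, .inl v => G.Adj u v
    | .inl v, .inr e => v ∈ e.1
    | .inr e, .inl v => v ∈ e.1
    | .inr e, .inr f => e ≠ f ∧ ∃ v, v ∈ e.1 ∧ v ∈ f.1
  symm := ⟨by
    rintro (u | e) (v | f) h
    exacts [G.adj_symm h, h, h, ⟨h.1.symm, h.2.imp fun _ => And.symm⟩]⟩
  loopless := ⟨by
    rintro (v | e) h
    exacts [G.irrefl h, h.1 rfl]⟩

/-- The total coloring given by a proper coloring of the total graph. -/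
def totalColoringOfColoring {k : ℕ} (c : (totalGraph G).Coloring (Fin k)) : G.TotalColoring k where
  vert v := c (.inl v)
  edge e := c (.inr e)
  vert_ne u v h := c.valid (v := .inl u) (w := .inl v) h
  edge_ne e f hef v he hf := c.valid (v := .inr e) (w := .inr f) ⟨hef, v, he, hf⟩
  vert_ne_edge v e h := c.valid (v := .inl v) (w := .inr e) h

/-- The vertices and edges of a subgraph `H`, as vertices of the total graph of `G`. -/
def totalGraphInclusion (H : G.Subgraph) : H.verts ⊕ H.coe.edgeSet → V ⊕ G.edgeSet :=
  Sum.map (↑) H.hom.mapEdgeSet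

variable {H : G.Subgraph}

theorem totalGraphInclusion_injective : (totalGraphInclusion H).Injective :=
  Subtype.val_injective.sumMap (Hom.mapEdgeSet.injective _ Subtype.val_injective)

theorem inl_mem_range_totalGraphInclusion {v : V} :
    .inl v ∈ Set.range (totalGraphInclusion H) ↔ v ∈ H.verts := by
  simp [totalGraphInclusion]

theorem adj_of_inr_mem_range_totalGraphInclusion {e : G.edgeSet} {v w : V}
    (he : .inr e ∈ Set.range (totalGraphInclusion H)) (hvw : e.1 = s(v, w)) : H.Adj v w := by
  obtain ⟨_ | ⟨f, hf⟩, hfe⟩ := he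
  · simp [totalGraphInclusion] at hfe
  obtain rfl : H.hom.mapEdgeSet ⟨f, hf⟩ = e := Sum.inr_injective hfe
  induction f with | _ a b
  exact (H.mem_edgeSet (v := v)).1 (hvw ▸ H.mem_edgeSet.2 hf)

theorem elim_ne_elim_of_totalGraph_adj {k : ℕ} {φ : H.coe.TotalColoring k} (hφ : φ.IsIn)
    {x y : H.verts ⊕ H.coe.edgeSet}
    (h : (totalGraph G).Adj (totalGraphInclusion H x) (totalGraphInclusion H y)) :
    Sum.elim φ.vert φ.edge x ≠ Sum.elim φ.vert φ.edge y := by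
  have mem_of_map_mem {v : H.verts} {e : H.coe.edgeSet} (hve : v.1 ∈ (H.hom.mapEdgeSet e).1) :
      v ∈ e.1 := by
    obtain ⟨w, hw, hwv⟩ := Sym2.mem_map.1 hve
    exact Subtype.ext hwv ▸ hw
  rcases x with u | e <;> rcases y with v | f
  · exact hφ u v h
  · exact φ.vert_ne_edge u f (mem_of_map_mem h)
  · exact (φ.vert_ne_edge v e (mem_of_map_mem h)).symm
  · obtain ⟨hef, _, hve, hvf⟩ := h
    obtain ⟨v, hv, rfl⟩ := Sym2.mem_map.1 hve
    exact φ.edge_ne e f (fun h => hef (h ▸ rfl)) v hv (mem_of_map_mem hvf)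

variable [Fintype V] [DecidableRel G.Adj]

theorem ncard_neighborSet_inl_inter_le {Y : Set (V ⊕ G.edgeSet)} {v : V}
    (hY : ∀ e : G.edgeSet, .inr e ∈ Y → v ∉ e.1) :
    ((totalGraph G).neighborSet (.inl v) ∩ Y).ncard ≤ G.maxDegree := by
  have neighbors_subset : (totalGraph G).neighborSet (.inl v) ∩ Y ⊆
      .inl '' (G.neighborFinset v : Set V) := by
    rintro (w | e) ⟨hadj, hmem⟩
    · exact ⟨w, mem_coe.2 ((G.mem_neighborFinset v w).2 hadj), rfl⟩
    · exact absurd hadj (hY e hmem)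
  calc _ ≤ _ := Set.ncard_le_ncard neighbors_subset
    _ = G.degree v := by
      rw [Set.ncard_image_of_injective _ Sum.inl_injective, Set.ncard_coe_finset, degree]
    _ ≤ G.maxDegree := G.degree_le_maxDegree v

theorem ncard_neighborSet_inr_inter_le {Y : Set (V ⊕ G.edgeSet)} {e : G.edgeSet} {v : V}
    (he : .inr e ∈ Y) (hv : v ∈ e.1) :
    ((totalGraph G).neighborSet (.inr e) ∩ Y).ncard ≤
      {f : G.edgeSet | .inr f ∈ Y ∧ v ∈ f.1}.ncard + G.maxDegree := by
  obtain ⟨w, hw⟩ := hv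
  have hwe : w ∈ e.1 := hw ▸ Sym2.mem_mk_right v w
  have hve : v ∈ e.1 := hw ▸ Sym2.mem_mk_left v w
  have neighbors_subset : (totalGraph G).neighborSet (.inr e) ∩ Y ⊆ .inl '' {v, w} ∪
      .inr '' (({f | .inr f ∈ Y ∧ v ∈ f.1} \ {e}) ∪ ({f | w ∈ f.1} \ {e})) := by
    rintro (u | f) ⟨hadj, hmem⟩
    · have hu : u ∈ e.1 := hadj
      rw [hw, Sym2.mem_iff] at hu
      exact Or.inl ⟨u, hu, rfl⟩
    · obtain ⟨hef, u, hue, huf⟩ := hadj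
      rw [hw, Sym2.mem_iff] at hue
      refine Or.inr ⟨f, ?_, rfl⟩
      rcases hue with rfl | rfl
      · exact Or.inl ⟨⟨hmem, huf⟩, hef.symm⟩
      · exact Or.inr ⟨huf, hef.symm⟩
  have at_w : {f : G.edgeSet | w ∈ f.1}.ncard ≤ G.maxDegree := by
    have := ncard_incident_le (F := (Set.univ : Set G.edgeSet)) (v := w)
      (G.neighborFinset w).finite_toSet
      fun f _ u hu => by simpa using G.mem_edgeSet.1 (hu ▸ f.2)
    rw [Set.ncard_coe_finset] at this
    simpa using this.trans (G.degree_le_maxDegree w)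
  have other_at_v := Set.ncard_sdiff_singleton_add_one
    (s := {f : G.edgeSet | .inr f ∈ Y ∧ v ∈ f.1}) ⟨he, hve⟩
  have other_at_w := Set.ncard_sdiff_singleton_add_one (s := {f : G.edgeSet | w ∈ f.1}) hwe
  have hle := (Set.ncard_le_ncard neighbors_subset).trans (Set.ncard_union_le _ _)
  rw [Set.ncard_image_of_injective _ Sum.inl_injective,
    Set.ncard_image_of_injective _ Sum.inr_injective,
    Set.ncard_pair (G.ne_of_adj (G.mem_edgeSet.1 (hw ▸ e.2)))] at hle
  have := Set.ncard_union_le ({f : G.edgeSet | .inr f ∈ Y ∧ v ∈ f.1} \ {e}) ({f | w ∈ f.1} \ {e})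
  lia

theorem exists_ncard_neighborSet_inter_le {d m : ℕ} (hG : IsDegenerate G d)
    (hH : ∀ v, (H.neighborSet v).ncard ≤ m) {Y : Set (V ⊕ G.edgeSet)}
    (hY : Set.range (totalGraphInclusion H) ⊂ Y) :
    ∃ x ∈ Y \ Set.range (totalGraphInclusion H),
      ((totalGraph G).neighborSet x ∩ Y).ncard ≤ G.maxDegree + d + m := by
  let F : Set G.edgeSet := {e | .inr e ∈ Y \ Set.range (totalGraphInclusion H)}
  rcases F.eq_empty_or_nonempty with hF | hF
  · have edges_mem (e : G.edgeSet) (he : .inr e ∈ Y) :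
        .inr e ∈ Set.range (totalGraphInclusion H) := by
      by_contra hmem
      exact hF.subset (show e ∈ F from ⟨he, hmem⟩)
    obtain ⟨_ | e, hxY, hx⟩ := Set.exists_of_ssubset hY
    · refine ⟨_, ⟨hxY, hx⟩, (ncard_neighborSet_inl_inter_le fun e he hv => hx ?_).trans
        (by lia)⟩
      obtain ⟨w, hw⟩ := hv
      exact inl_mem_range_totalGraphInclusion.2
        (adj_of_inr_mem_range_totalGraphInclusion (edges_mem e he) hw).fst_mem
    · exact absurd (edges_mem e hxY) hx
  · obtain ⟨e, he, v, hv, at_v⟩ := hG.exists_ncard_incident_le F.toFinite hF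
    have H_at_v : {f ∈ {f : G.edgeSet | .inr f ∈ Set.range (totalGraphInclusion H)} |
        v ∈ f.1}.ncard ≤ (H.neighborSet v).ncard :=
      ncard_incident_le (Set.toFinite _) fun f hf w hw =>
        adj_of_inr_mem_range_totalGraphInclusion hf hw
    have edges_subset : {f : G.edgeSet | .inr f ∈ Y ∧ v ∈ f.1} ⊆ {f ∈ F | v ∈ f.1} ∪
        {f ∈ {f : G.edgeSet | .inr f ∈ Set.range (totalGraphInclusion H)} | v ∈ f.1} :=
      fun f ⟨hf, hvf⟩ => (em (.inr f ∈ Set.range (totalGraphInclusion H))).elim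
        (fun h => Or.inr ⟨h, hvf⟩) fun h => Or.inl ⟨⟨hf, h⟩, hvf⟩
    have edges_le := (Set.ncard_le_ncard edges_subset).trans (Set.ncard_union_le _ _)
    have := ncard_neighborSet_inr_inter_le he.1 hv
    have := hH v
    exact ⟨_, he, by lia⟩

theorem mainTheorem6_general {d m k : ℕ} (hG : IsDegenerate G d)
    (hH : ∀ v, (H.neighborSet v).ncard ≤ m) (hk : G.maxDegree + d + m < k)
    {φ : H.coe.TotalColoring k} (hφ : φ.IsIn) : ∃ ψ : G.TotalColoring k, ψ.Extends φ := by
  have : NeZero k := ⟨by lia⟩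
  let c₀ : V ⊕ G.edgeSet → Fin k :=
    Function.extend (totalGraphInclusion H) (Sum.elim φ.vert φ.edge) 0
  have c₀_inclusion (x) : c₀ (totalGraphInclusion H x) = Sum.elim φ.vert φ.edge x :=
    totalGraphInclusion_injective.extend_apply _ _ x
  obtain ⟨c, hc⟩ : ∃ c : (totalGraph G).Coloring (Fin k),
      Set.EqOn c c₀ (Set.range (totalGraphInclusion H)) := by
    refine exists_coloring_eqOn _ ?_ fun Y hY => ?_
    · rintro _ ⟨x, rfl⟩ _ ⟨y, rfl⟩ hxy
      rw [c₀_inclusion, c₀_inclusion]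
      exact elim_ne_elim_of_totalGraph_adj hφ hxy
    · obtain ⟨x, hx, hle⟩ := exists_ncard_neighborSet_inter_le hG hH hY
      exact ⟨x, hx, by simpa using hle.trans_lt hk⟩
  have c_inclusion (x) : c (totalGraphInclusion H x) = Sum.elim φ.vert φ.edge x :=
    (hc ⟨x, rfl⟩).trans (c₀_inclusion x)
  exact ⟨totalColoringOfColoring c, fun v => c_inclusion (.inl v), fun e => c_inclusion (.inr e)⟩

end TotalGraph

theorem mainTheorem6 {V : Type*} [Fintype V] (G : SimpleGraph V) [DecidableRel G.Adj]
    (hG : G.IsPlanar) (H : G.Subgraph) (hH : H.IsMatching)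
    (φ : H.coe.TotalColoring (G.maxDegree + 7)) (hφ : φ.IsIn) :
    ∃ ψ : G.TotalColoring (G.maxDegree + 7), ψ.Extends φ :=
  mainTheorem6_general (m := 1) (isDegenerate_five_of_isPlanar hG)
    (fun v => Set.ncard_le_one_iff_subsingleton.2 fun _ ha _ hb => (hH ha.fst_mem).unique ha hb)
    (by lia) hφ
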